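/- Let $\mathbb{H}$ be the quaternions and $\mathbb{S}=\{q\in\mathbb{H}: q^2=-1\}$; for $I\in\mathbb{S}$ put $L_I=\mathbb{R}+I\mathbb{R}\simeq\mathbb{C}$ and, for $\Omega\subseteq\mathbb{H}$, $\Omega_I=\Omega\cap L_I$. A domain is a non-empty connected open set. A domain $\Omega\subseteq\mathbb{H}$ is a slice domain if $\Omega\cap\mathbb{R}\neq\emptyset$ and $\Omega_I$ is a domain in $L_I$ for every $I\in\mathbb{S}$. A set $C\subseteq\mathbb{H}$ is symmetric if, whenever $x+yI\in C$ with $x,y\in\mathbb{R}$ and $I\in\mathbb{S}$, the whole set $x+y\mathbb{S}=\{x+yJ: J\in\mathbb{S}\}$ is contained in $C$. A function $f:\Omega\to\mathbb{H}$ on a domain $\Omega$ is regular if, for every $I\in\mathbb{S}$, the restriction $f_I=f|_{\Omega_I}$ is of class $C^1$ on $\Omega_I$ and $$\frac12\left(\frac{\partial}{\partial x}+I\,\frac{\partial}{\partial y}\right)f_I(x+yI)=0\qquad\text{for all } x+yI\in\Omega_I .$$ Theorem. Let $\Omega$ be a symmetric slice domain and let $f:\Omega\to\mathbb{H}$ be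 a non-constant regular function. If $U$ is a symmetric open subset of $\Omega$, then $f(U)$ is open in $\mathbb{H}$. In particular, the image $f(\Omega)$ is open. -/

import Mathlib

open scoped Quaternion

noncomputable section

namespace SliceRegular

/-- The 2-sphere `𝕊` of quaternionic imaginary units. -/
def imaginaryUnits : Set ℍ := {q : ℍ | q ^ 2 = -1}

/-- The point `x + y I` of the complex line `L_I = ℝ + I ℝ`, for `z = x + y i ∈ ℂ`.
For `I ∈ 𝕊` this is the identification of `ℂ` with `L_I`. -/
def sliceMap (I : ℍ) (z : ℂ) : ℍ := (z.re : ℍ) + (z.im : ℍ) * I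

/-- The slice `Ω_I = Ω ∩ L_I`, read in `ℂ` through the identification `L_I ≃ ℂ`. -/
def slice (Ω : Set ℍ) (I : ℍ) : Set ℂ := sliceMap I ⁻¹' Ω

/-- The restriction `f_I` of `f` to `L_I`, read in `ℂ`: the function `x + y i ↦ f (x + y I)`. -/
def sliceRestrict (f : ℍ → ℍ) (I : ℍ) : ℂ → ℍ := fun z => f (sliceMap I z)

/-- The operator `∂̄_I f (x + y I) = (1 / 2) (∂ / ∂x + I ∂ / ∂y) f_I (x + y I)`. -/
def dbar (I : ℍ) (f : ℍ → ℍ) (z : ℂ) : ℍ :=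
  (1 / 2 : ℝ) • (fderiv ℝ (sliceRestrict f I) z 1
    + I * fderiv ℝ (sliceRestrict f I) z Complex.I)

/-- `f` is (slice) regular on `Ω`: for each imaginary unit `I`, the restriction `f_I` is of class
`C¹` on `Ω_I` and `∂̄_I f` vanishes on `Ω_I`. It is used for open sets `Ω`, where only the values
of `f` on `Ω` matter. -/
def IsRegularOn (f : ℍ → ℍ) (Ω : Set ℍ) : Prop :=
  ∀ I ∈ imaginaryUnits,
    ContDiffOn ℝ 1 (sliceRestrict f I) (slice Ω I) ∧ ∀ z ∈ slice Ω I, dbar I f z = 0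

/-- A slice domain: a domain of `ℍ` that meets the real axis and all of whose slices `Ω_I` are
domains of `L_I ≃ ℂ` (a domain is a non-empty connected open set). -/
structure IsSliceDomain (Ω : Set ℍ) : Prop where
  isOpen : IsOpen Ω
  isConnected : IsConnected Ω
  meets_real : ∃ x : ℝ, (x : ℍ) ∈ Ω
  isOpen_slice : ∀ I ∈ imaginaryUnits, IsOpen (slice Ω I)
  isConnected_slice : ∀ I ∈ imaginaryUnits, IsConnected (slice Ω I)

/-- (Axially) symmetric sets: with `x + y I`, they contain the whole set `x + y 𝕊`. -/
def IsSymmetric (C : Set ℍ) : Prop :=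
  ∀ (x y : ℝ), ∀ I ∈ imaginaryUnits, (x : ℍ) + (y : ℍ) * I ∈ C →
    ∀ J ∈ imaginaryUnits, (x : ℍ) + (y : ℍ) * J ∈ C

end SliceRegular

end

open Complex Metric Filter Topology
open scoped Quaternion

noncomputable section

namespace SliceRegular

/-! On a symmetric slice domain f (x + yJ) = a + J b, with a and b independent of J; the stem
function F = a + i b, with values in ℍ ⊗ ℂ ≃ ℂ⁴, is holomorphic on the slice. Different slices give
the same F because they agree on the reals (`IsRegularOn.stem_eq`). Some J ∈ 𝕊 solves a + J b = p
exactly when |a - p| = |b| and a - p ⟂ b, that is, when the single complex number ∑ (F_k - p_k)²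
vanishes (`symNorm_eq_zero_iff`). Since U contains whole spheres x + y𝕊, p lies in f(U) iff this
holomorphic function of z has a zero in the slice of U. It varies continuously with p, so by Hurwitz
(`eventually_exists_zero`) the zero survives for nearby p unless the function vanishes identically;
in that case f = p on the reals, hence everywhere. -/

theorem continuous_sliceMap (I : ℍ) : Continuous (sliceMap I) := by
  unfold sliceMap
  have h := Quaternion.continuous_coe
  exact (h.comp continuous_re).add ((h.comp continuous_im).mul continuous_const)

theorem mem_imaginaryUnits_iff {q : ℍ} :
    q ∈ imaginaryUnits ↔ q.re = 0 ∧ q.imI ^ 2 + q.imJ ^ 2 + q.imK ^ 2 = 1 := by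
  simp only [imaginaryUnits, Set.mem_ofPred_eq, sq, Quaternion.ext_iff]
  simp only [Quaternion.re_mul, Quaternion.imI_mul, Quaternion.imJ_mul, Quaternion.imK_mul,
    Quaternion.re_neg, Quaternion.imI_neg, Quaternion.imJ_neg, Quaternion.imK_neg,
    Quaternion.re_one, Quaternion.imI_one, Quaternion.imJ_one, Quaternion.imK_one]
  constructor
  · rintro ⟨h0, h1, h2, h3⟩
    have hre : q.re = 0 := by
      by_contra hne
      have e1 : q.imI = 0 := by
        have : q.re * q.imI = 0 := by linarith
        exact (mul_eq_zero.1 this).resolve_left hne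
      have e2 : q.imJ = 0 := by
        have : q.re * q.imJ = 0 := by linarith
        exact (mul_eq_zero.1 this).resolve_left hne
      have e3 : q.imK = 0 := by
        have : q.re * q.imK = 0 := by linarith
        exact (mul_eq_zero.1 this).resolve_left hne
      rw [e1, e2, e3] at h0
      nlinarith [mul_self_nonneg q.re]
    refine ⟨hre, ?_⟩
    rw [hre] at h0
    linarith
  · rintro ⟨h0, h1⟩
    rw [h0]
    refine ⟨by linarith, by ring, by ring, by ring⟩

theorem mul_self_of_mem_imaginaryUnits {I : ℍ} (hI : I ∈ imaginaryUnits) : I * I = -1 := by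
  rw [← sq]; exact hI

theorem neg_mem_imaginaryUnits {I : ℍ} (hI : I ∈ imaginaryUnits) : -I ∈ imaginaryUnits := by
  simpa [imaginaryUnits] using hI

theorem exists_mem_imaginaryUnits : ∃ I : ℍ, I ∈ imaginaryUnits :=
  ⟨⟨0, 1, 0, 0⟩, mem_imaginaryUnits_iff.2 (by simp)⟩

theorem exists_sliceMap_eq (q : ℍ) : ∃ I ∈ imaginaryUnits, ∃ z, sliceMap I z = q := by
  set r := √(q.imI ^ 2 + q.imJ ^ 2 + q.imK ^ 2) with hr
  have hr2 : r ^ 2 = q.imI ^ 2 + q.imJ ^ 2 + q.imK ^ 2 := Real.sq_sqrt (by positivity)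
  by_cases h : r = 0
  · obtain ⟨I, hI⟩ := exists_mem_imaginaryUnits
    have h0 : q.imI ^ 2 + q.imJ ^ 2 + q.imK ^ 2 = 0 := by rw [← hr2, h]; simp
    refine ⟨I, hI, ⟨q.re, 0⟩, ?_⟩
    have e1 : q.imI = 0 := by nlinarith [sq_nonneg q.imI, sq_nonneg q.imJ, sq_nonneg q.imK]
    have e2 : q.imJ = 0 := by nlinarith [sq_nonneg q.imI, sq_nonneg q.imJ, sq_nonneg q.imK]
    have e3 : q.imK = 0 := by nlinarith [sq_nonneg q.imI, sq_nonneg q.imJ, sq_nonneg q.imK]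
    ext <;> simp [sliceMap, e1, e2, e3]
  · refine ⟨r⁻¹ • q.im, ?_, ⟨q.re, r⟩, ?_⟩
    · rw [mem_imaginaryUnits_iff]
      simp only [Quaternion.re_smul, Quaternion.imI_smul, Quaternion.imJ_smul,
        Quaternion.imK_smul, Quaternion.re_im, Quaternion.imI_im, Quaternion.imJ_im,
        Quaternion.imK_im, smul_eq_mul, mul_zero, mul_pow, ← mul_add, ← hr2, true_and]
      rw [← mul_pow, inv_mul_cancel₀ h, one_pow]
    · rw [sliceMap, Quaternion.coe_mul_eq_smul, smul_smul, mul_inv_cancel₀ h, one_smul]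
      exact Quaternion.re_add_im q

theorem sliceMap_conj (I : ℍ) (z : ℂ) :
    sliceMap I ((starRingEnd ℂ) z) = sliceMap (-I) z := by
  simp [sliceMap]

theorem sliceMap_ofReal (I : ℍ) (x : ℝ) : sliceMap I x = x := by simp [sliceMap]

theorem IsSymmetric.slice_eq {C : Set ℍ} (hC : IsSymmetric C) {I J : ℍ}
    (hI : I ∈ imaginaryUnits) (hJ : J ∈ imaginaryUnits) : slice C I = slice C J :=
  Set.ext fun z => ⟨fun h => hC z.re z.im I hI h J hJ, fun h => hC z.re z.im J hJ h I hI⟩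

theorem IsSymmetric.conj_mem_slice {C : Set ℍ} (hC : IsSymmetric C) {I : ℍ}
    (hI : I ∈ imaginaryUnits) {z : ℂ} (hz : z ∈ slice C I) :
    (starRingEnd ℂ) z ∈ slice C I := by
  show sliceMap I _ ∈ C
  rw [sliceMap_conj]
  exact hC z.re z.im I hI hz (-I) (neg_mem_imaginaryUnits hI)

/-! ### Stem functions -/

/-- The component `a` of the decomposition `f (x + y I) = a (x, y) + I b (x, y)`. -/
def evenPart (f : ℍ → ℍ) (I : ℍ) (z : ℂ) : ℍ :=
  (2⁻¹ : ℝ) • (sliceRestrict f I z + sliceRestrict f I ((starRingEnd ℂ) z))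

/-- The component `b` of the decomposition `f (x + y I) = a (x, y) + I b (x, y)`. -/
def oddPart (f : ℍ → ℍ) (I : ℍ) (z : ℂ) : ℍ :=
  -I * (2⁻¹ : ℝ) • (sliceRestrict f I z - sliceRestrict f I ((starRingEnd ℂ) z))

theorem evenPart_add_mul_oddPart (f : ℍ → ℍ) {I : ℍ} (hI : I ∈ imaginaryUnits) (z : ℂ) :
    evenPart f I z + I * oddPart f I z = f (sliceMap I z) := by
  rw [evenPart, oddPart, ← mul_assoc, mul_neg, mul_self_of_mem_imaginaryUnits hI, neg_neg, one_mul,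
    ← smul_add, add_add_sub_cancel, ← two_smul ℝ, smul_smul]
  norm_num [sliceRestrict]

theorem evenPart_ofReal (f : ℍ → ℍ) (I : ℍ) (x : ℝ) : evenPart f I x = f x := by
  rw [evenPart, conj_ofReal, ← two_smul ℝ, smul_smul]
  norm_num [sliceRestrict, sliceMap_ofReal]

theorem oddPart_ofReal (f : ℍ → ℍ) (I : ℍ) (x : ℝ) : oddPart f I x = 0 := by
  simp [oddPart]

/-- The real coordinates of a quaternion. -/
def coord : Fin 4 → ℍ →L[ℝ] ℝ :=
  ![(QuaternionAlgebra.reₗ _ _ _).toContinuousLinearMap,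
    (QuaternionAlgebra.imIₗ _ _ _).toContinuousLinearMap,
    (QuaternionAlgebra.imJₗ _ _ _).toContinuousLinearMap,
    (QuaternionAlgebra.imKₗ _ _ _).toContinuousLinearMap]

@[simp] theorem coord_zero (q : ℍ) : coord 0 q = q.re := rfl
@[simp] theorem coord_one (q : ℍ) : coord 1 q = q.imI := rfl
@[simp] theorem coord_two (q : ℍ) : coord 2 q = q.imJ := rfl
@[simp] theorem coord_three (q : ℍ) : coord 3 q = q.imK := rfl

theorem ext_coord {p q : ℍ} (h : ∀ k, coord k p = coord k q) : p = q := by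
  ext
  exacts [h 0, h 1, h 2, h 3]

/-- The complex coordinates of the stem function `a + i b` of `f`. -/
def stem (f : ℍ → ℍ) (I : ℍ) (k : Fin 4) (z : ℂ) : ℂ :=
  (coord k (evenPart f I z) : ℂ) + coord k (oddPart f I z) * Complex.I

theorem stem_ofReal (f : ℍ → ℍ) (I : ℍ) (k : Fin 4) (x : ℝ) : stem f I k x = coord k (f x) := by
  simp [stem, evenPart_ofReal, oddPart_ofReal]

theorem stem_eq_stem_iff {f g : ℍ → ℍ} {I J : ℍ} {z w : ℂ} :
    (∀ k, stem f I k z = stem g J k w) ↔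
      evenPart f I z = evenPart g J w ∧ oddPart f I z = oddPart g J w := by
  constructor
  · intro h
    constructor <;> refine ext_coord fun k => ?_
    · simpa [stem] using congrArg Complex.re (h k)
    · simpa [stem] using congrArg Complex.im (h k)
  · rintro ⟨h1, h2⟩ k
    simp [stem, h1, h2]

theorem hasFDerivAt_conj_comp {g : ℂ → ℍ} {z : ℂ} {L : ℂ →L[ℝ] ℍ}
    (h : HasFDerivAt g L ((starRingEnd ℂ) z)) :
    HasFDerivAt (fun w => g ((starRingEnd ℂ) w)) (L.comp (conjCLE : ℂ →L[ℝ] ℂ)) z :=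
  HasFDerivAt.comp z (f := fun w => (starRingEnd ℂ) w) h conjCLE.hasFDerivAt

/-- The equations at z and at its conjugate combine into ∂a/∂x = ∂b/∂y and ∂a/∂y = -∂b/∂x, the
Cauchy–Riemann system for each coordinate of a + i b. -/
theorem differentiableAt_stem {f : ℍ → ℍ} {I : ℍ} (hI : I ∈ imaginaryUnits) {z : ℂ}
    (h1 : DifferentiableAt ℝ (sliceRestrict f I) z)
    (h2 : DifferentiableAt ℝ (sliceRestrict f I) ((starRingEnd ℂ) z))
    (d1 : dbar I f z = 0) (d2 : dbar I f ((starRingEnd ℂ) z) = 0) (k : Fin 4) :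
    DifferentiableAt ℂ (stem f I k) z := by
  -- Left multiplication by I turns f_x + I f_y = 0 into f_y = I f_x.
  have cr : ∀ w, dbar I f w = 0 → fderiv ℝ (sliceRestrict f I) w Complex.I =
      I * fderiv ℝ (sliceRestrict f I) w 1 := by
    intro w hw
    have h0 := (smul_eq_zero.1 hw).resolve_left (by norm_num)
    have := congrArg (I * ·) h0
    simp only [mul_add, ← mul_assoc, mul_self_of_mem_imaginaryUnits hI, mul_zero, neg_mul,
      one_mul] at this
    exact (sub_eq_zero.1 ((sub_eq_add_neg _ _).trans this)).symm
  have c1 := cr _ d1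
  have c2 := cr _ d2
  have H1 := h1.hasFDerivAt
  have H2 := hasFDerivAt_conj_comp h2.hasFDerivAt
  set L := fderiv ℝ (sliceRestrict f I) z
  set L' := fderiv ℝ (sliceRestrict f I) ((starRingEnd ℂ) z)
  have HA := (H1.add H2).const_smul (2⁻¹ : ℝ)
  have HB := ((H1.sub H2).const_smul (2⁻¹ : ℝ)).const_mul (-I)
  have HA' := ofRealCLM.hasFDerivAt.comp z ((coord k).hasFDerivAt.comp z HA)
  have HB' := (ofRealCLM.hasFDerivAt.comp z ((coord k).hasFDerivAt.comp z HB)).mul_const Complex.I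
  have H := HA'.add HB'
  refine (HasFDerivAt.complexOfReal_hasFDerivAt H ?_).differentiableAt
  have hII := mul_self_of_mem_imaginaryUnits hI
  simp [c1, c2, hII, ← mul_assoc, mul_add, mul_sub]
  ring

/-! ### Symmetrization and attained values -/

/-- The value at a point of the symmetrization of `f - p`, in terms of the value `F` of the
stem function of `f` at this point. -/
def symNorm (F : Fin 4 → ℂ) (p : ℍ) : ℂ := ∑ k, (F k - coord k p) ^ 2

/-- Multiplication by J ∈ 𝕊 preserves the norm and sends b to a vector orthogonal to b. Conversely,
for b ≠ 0, J = -a b⁻¹ has norm one, and its real part is a multiple of ⟨a, b⟩ = 0. -/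
theorem exists_mul_eq_iff (a b : ℍ) :
    (∃ J ∈ imaginaryUnits, a + J * b = 0) ↔
      a.re ^ 2 + a.imI ^ 2 + a.imJ ^ 2 + a.imK ^ 2 = b.re ^ 2 + b.imI ^ 2 + b.imJ ^ 2 + b.imK ^ 2 ∧
      a.re * b.re + a.imI * b.imI + a.imJ * b.imJ + a.imK * b.imK = 0 := by
  constructor
  · rintro ⟨J, hJ, h⟩
    obtain ⟨h0, h1⟩ := mem_imaginaryUnits_iff.1 hJ
    have ha : a = -(J * b) := eq_neg_of_add_eq_zero_left h
    subst ha
    simp only [Quaternion.re_neg, Quaternion.imI_neg, Quaternion.imJ_neg, Quaternion.imK_neg,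
      Quaternion.re_mul, Quaternion.imI_mul, Quaternion.imJ_mul, Quaternion.imK_mul, h0]
    constructor
    · linear_combination (b.re ^ 2 + b.imI ^ 2 + b.imJ ^ 2 + b.imK ^ 2) * h1
    · ring
  · rintro ⟨h1, h2⟩
    by_cases hb : b = 0
    · obtain ⟨J, hJ⟩ := exists_mem_imaginaryUnits
      refine ⟨J, hJ, ?_⟩
      subst hb
      simp only [Quaternion.re_zero, Quaternion.imI_zero, Quaternion.imJ_zero,
        Quaternion.imK_zero] at h1
      have ha : Quaternion.normSq a = 0 := by rw [Quaternion.normSq_def']; linarith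
      rw [Quaternion.normSq_eq_zero.1 ha]
      simp
    · have hn : Quaternion.normSq b ≠ 0 := fun h => hb (Quaternion.normSq_eq_zero.1 h)
      refine ⟨-(a * b⁻¹), ?_, by rw [neg_mul, mul_assoc, inv_mul_cancel₀ hb]; simp⟩
      have key : ∀ q : ℍ, q.re = 0 → Quaternion.normSq q = 1 → q ∈ imaginaryUnits := by
        intro q h0 h1
        rw [Quaternion.normSq_def', h0] at h1
        exact mem_imaginaryUnits_iff.2 ⟨h0, by linarith⟩
      refine key _ ?_ ?_
      · rw [Quaternion.re_neg, Quaternion.inv_def, mul_smul_comm, Quaternion.re_smul,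
          Quaternion.re_mul]
        simp only [Quaternion.re_star, Quaternion.imI_star, Quaternion.imJ_star,
          Quaternion.imK_star, smul_eq_mul]
        linear_combination -(Quaternion.normSq b)⁻¹ * h2
      · rw [Quaternion.normSq_neg, map_mul, Quaternion.normSq_inv]
        have : Quaternion.normSq a = Quaternion.normSq b := by
          rw [Quaternion.normSq_def', Quaternion.normSq_def']; linarith
        rw [this, mul_inv_cancel₀ hn]

/-- The sum of squares has real part |a - p|² - |b|² and imaginary part 2⟨a - p, b⟩. -/
theorem symNorm_eq_zero_iff (a b p : ℍ) :
    symNorm (fun k => (coord k a : ℂ) + coord k b * Complex.I) p = 0 ↔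
      ∃ J ∈ imaginaryUnits, a + J * b = p := by
  have h := exists_mul_eq_iff (a - p) b
  simp only [sub_add_eq_add_sub, sub_eq_zero] at h
  rw [h, symNorm, Fin.sum_univ_four, Complex.ext_iff]
  simp only [coord_zero, coord_one, coord_two, coord_three, sq, Complex.add_re, Complex.add_im,
    Complex.sub_re, Complex.sub_im, Complex.mul_re, Complex.mul_im, Complex.ofReal_re,
    Complex.ofReal_im, Complex.I_re, Complex.I_im, Complex.zero_re, Complex.zero_im,
    Quaternion.re_sub, Quaternion.imI_sub, Quaternion.imJ_sub, Quaternion.imK_sub]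
  constructor
  · rintro ⟨h1, h2⟩
    constructor <;> linarith
  · rintro ⟨h1, h2⟩
    constructor <;> linarith

theorem symNorm_coord_eq_zero_iff (q p : ℍ) :
    symNorm (fun k => (coord k q : ℂ)) p = 0 ↔ q = p := by
  have h := symNorm_eq_zero_iff q 0 p
  simp only [map_zero, ofReal_zero, zero_mul, add_zero, mul_zero] at h
  rw [h]
  obtain ⟨J, hJ⟩ := exists_mem_imaginaryUnits
  exact ⟨fun ⟨_, _, h⟩ => h, fun h => ⟨J, hJ, h⟩⟩

theorem continuous_symNorm : Continuous fun x : (Fin 4 → ℂ) × ℍ => symNorm x.1 x.2 := by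
  unfold symNorm
  fun_prop

theorem differentiableOn_symNorm {F : Fin 4 → ℂ → ℂ} {D : Set ℂ}
    (hF : ∀ k, DifferentiableOn ℂ (F k) D) (p : ℍ) :
    DifferentiableOn ℂ (fun z => symNorm (fun k => F k z) p) D := by
  unfold symNorm
  fun_prop

/-! ### Hurwitz's theorem and the identity principle -/

/-- Hurwitz's theorem: zeros of finite order persist under perturbation of the parameter. -/
theorem eventually_exists_zero {X : Type*} [TopologicalSpace X] {N : X → ℂ → ℂ} {V D : Set ℂ}
    {p₀ : X} {z₀ : ℂ} (hD : IsOpen D) (hDc : IsPreconnected D) (hV : IsOpen V) (hVD : V ⊆ D)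
    (hN : ∀ p, DifferentiableOn ℂ (N p) D)
    (hc : ∀ z ∈ D, ContinuousAt (fun x : X × ℂ => N x.1 x.2) (p₀, z))
    (hz₀ : z₀ ∈ V) (h0 : N p₀ z₀ = 0) (hne : ∃ z ∈ D, N p₀ z ≠ 0) :
    ∀ᶠ p in 𝓝 p₀, ∃ z ∈ V, N p z = 0 := by
  have han : ∀ p, AnalyticOnNhd ℂ (N p) D := fun p => (hN p).analyticOnNhd hD
  have hiso : ∀ᶠ z in 𝓝[≠] z₀, N p₀ z ≠ 0 := by
    refine ((han p₀) z₀ (hVD hz₀)).eventually_eq_zero_or_eventually_ne_zero.resolve_left ?_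
    intro h
    obtain ⟨z, hz, hz0⟩ := hne
    exact hz0 ((han p₀).eqOn_zero_of_preconnected_of_eventuallyEq_zero hDc (hVD hz₀) h hz)
  rw [eventually_nhdsWithin_iff] at hiso
  -- A closed disc inside V in which z₀ is the only zero.
  obtain ⟨r, hr, hball⟩ := nhds_basis_closedBall.mem_iff.1 (hiso.and (hV.mem_nhds hz₀))
  have hrV : closedBall z₀ r ⊆ V := fun z hz => (hball hz).2
  have hrD := hrV.trans hVD
  have hsph : ∀ z ∈ sphere z₀ r, N p₀ z ≠ 0 := fun z hz =>
    (hball (sphere_subset_closedBall hz)).1 (ne_of_mem_sphere hz hr.ne')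
  have hsne : (sphere z₀ r).Nonempty := NormedSpace.sphere_nonempty.2 hr.le
  obtain ⟨w, hw, hmin⟩ := (isCompact_sphere z₀ r).exists_isMinOn hsne
    ((hN p₀).continuousOn.norm.mono (sphere_subset_closedBall.trans hrD))
  set m := ‖N p₀ w‖ with hm
  have hmpos : 0 < m := norm_pos_iff.2 (hsph w hw)
  have hp : ∀ z ∈ D, ContinuousAt (fun p => N p z) p₀ := fun z hz =>
    ContinuousAt.comp (f := fun p => (p, z)) (hc z hz) (by fun_prop)
  have ev1 : ∀ᶠ p in 𝓝 p₀, ∀ z ∈ sphere z₀ r, m / 2 < ‖N p z - N p z₀‖ := by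
    refine (isCompact_sphere z₀ r).eventually_forall_of_forall_eventually fun z hz => ?_
    have hzD := hrD (sphere_subset_closedBall hz)
    have hcont : ContinuousAt (fun x : X × ℂ => ‖N x.1 x.2 - N x.1 z₀‖) (p₀, z) :=
      ((hc z hzD).sub (ContinuousAt.comp (f := Prod.fst) (g := fun p => N p z₀) (x := (p₀, z))
        (hp z₀ (hVD hz₀)) continuousAt_fst)).norm
    refine hcont.eventually (lt_mem_nhds ?_)
    have hle : m ≤ ‖N p₀ z‖ := hmin hz
    simp only [h0, sub_zero]
    linarith
  have ev2 : ∀ᶠ p in 𝓝 p₀, ‖N p z₀‖ < m / 4 := by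
    refine (hp z₀ (hVD hz₀)).norm.eventually (gt_mem_nhds ?_)
    simp only [h0, norm_zero]
    linarith
  filter_upwards [ev1, ev2] with p h1 h2
  -- Quantitative open mapping: the gap m / 2 on the circle yields a disc of radius m / 4 in the
  -- image, which contains 0 because ‖N p z₀‖ < m / 4.
  have hsub : ball (N p z₀) (m / 2 / 2) ⊆ N p '' closedBall z₀ r := by
    refine DiffContOnCl.ball_subset_image_closedBall ?_ hr (fun z hz => (h1 z hz).le) ?_
    · exact (hN p).diffContOnCl_ball hrD
    -- Were `N p` constant near z₀, it would be constant on D, against the gap at w.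
    · intro hcon
      have hcon' : N p =ᶠ[𝓝 z₀] fun _ => N p z₀ := hcon.mono fun z hz => not_not.1 hz
      have := (han p).eqOn_of_preconnected_of_eventuallyEq (fun _ _ => analyticAt_const) hDc
        (hVD hz₀) hcon' (hrD (sphere_subset_closedBall hw))
      have h3 := h1 w hw
      rw [this, sub_self, norm_zero] at h3
      linarith
  obtain ⟨z, hz, hz0⟩ := hsub (show (0 : ℂ) ∈ _ by
    rw [mem_ball, dist_comm, dist_zero_right]; linarith)
  exact ⟨z, hrV hz, hz0⟩

/-- Holomorphic functions that coincide on the reals coincide. -/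
theorem eqOn_of_eq_ofReal {D : Set ℂ} (hD : IsOpen D) (hDc : IsPreconnected D) {x : ℝ}
    (hx : (x : ℂ) ∈ D) {g h : ℂ → ℂ} (hg : DifferentiableOn ℂ g D) (hh : DifferentiableOn ℂ h D)
    (hgh : ∀ t : ℝ, (t : ℂ) ∈ D → g t = h t) : Set.EqOn g h D := by
  refine (hg.analyticOnNhd hD).eqOn_of_preconnected_of_frequently_eq (hh.analyticOnNhd hD) hDc hx ?_
  have hev : ∀ᶠ t : ℝ in 𝓝[≠] x, g t = h t := nhdsWithin_le_nhds
    ((continuous_ofReal.continuousAt.eventually (hD.mem_nhds hx)).mono hgh)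
  have htend : Tendsto (fun t : ℝ => (t : ℂ)) (𝓝[≠] x) (𝓝[≠] (x : ℂ)) :=
    continuous_ofReal.continuousAt.continuousWithinAt.tendsto_nhdsWithin
      fun t ht => ofReal_injective.ne ht
  exact htend.frequently hev.frequently

/-! ### Regular functions on symmetric slice domains -/

section Regular

variable {Ω : Set ℍ} {f : ℍ → ℍ}

theorem IsRegularOn.differentiableOn_stem (hΩ : IsSliceDomain Ω) (hsymm : IsSymmetric Ω)
    (hf : IsRegularOn f Ω) {I : ℍ} (hI : I ∈ imaginaryUnits) (k : Fin 4) :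
    DifferentiableOn ℂ (stem f I k) (slice Ω I) := by
  intro z hz
  obtain ⟨h1, h2⟩ := hf I hI
  have hd : ∀ w ∈ slice Ω I, DifferentiableAt ℝ (sliceRestrict f I) w := fun w hw =>
    (h1.differentiableOn one_ne_zero).differentiableAt ((hΩ.isOpen_slice I hI).mem_nhds hw)
  have hz' := hsymm.conj_mem_slice hI hz
  exact (differentiableAt_stem hI (hd z hz) (hd _ hz') (h2 z hz) (h2 _ hz')
    k).differentiableWithinAt

theorem IsSliceDomain.exists_ofReal_mem_slice (hΩ : IsSliceDomain Ω) (I : ℍ) :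
    ∃ x : ℝ, (x : ℂ) ∈ slice Ω I := by
  obtain ⟨x, hx⟩ := hΩ.meets_real
  exact ⟨x, show sliceMap I x ∈ Ω by rwa [sliceMap_ofReal]⟩

/-- The stem function does not depend on the slice. -/
theorem IsRegularOn.stem_eq (hΩ : IsSliceDomain Ω) (hsymm : IsSymmetric Ω)
    (hf : IsRegularOn f Ω) {I J : ℍ} (hI : I ∈ imaginaryUnits) (hJ : J ∈ imaginaryUnits)
    (k : Fin 4) : Set.EqOn (stem f I k) (stem f J k) (slice Ω I) := by
  obtain ⟨x, hx⟩ := hΩ.exists_ofReal_mem_slice I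
  refine eqOn_of_eq_ofReal (hΩ.isOpen_slice I hI) (hΩ.isConnected_slice I hI).isPreconnected hx
    (hf.differentiableOn_stem hΩ hsymm hI k) ?_ fun t _ => ?_
  · rw [hsymm.slice_eq hI hJ]
    exact hf.differentiableOn_stem hΩ hsymm hJ k
  · rw [stem_ofReal, stem_ofReal]

/-- The representation formula. -/
theorem IsRegularOn.apply_sliceMap (hΩ : IsSliceDomain Ω) (hsymm : IsSymmetric Ω)
    (hf : IsRegularOn f Ω) {I J : ℍ} (hI : I ∈ imaginaryUnits) (hJ : J ∈ imaginaryUnits)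
    {z : ℂ} (hz : z ∈ slice Ω I) :
    f (sliceMap J z) = evenPart f I z + J * oddPart f I z := by
  obtain ⟨h1, h2⟩ := stem_eq_stem_iff.1 fun k => hf.stem_eq hΩ hsymm hI hJ k hz
  rw [h1, h2, evenPart_add_mul_oddPart f hJ]

/-- A value `p` is attained on a symmetric set exactly when the symmetrization of `f - p`
vanishes somewhere on its slice. -/
theorem IsRegularOn.mem_image_iff (hΩ : IsSliceDomain Ω) (hsymm : IsSymmetric Ω)
    (hf : IsRegularOn f Ω) {U : Set ℍ} (hUΩ : U ⊆ Ω) (hU : IsSymmetric U) {I : ℍ}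
    (hI : I ∈ imaginaryUnits) (p : ℍ) :
    p ∈ f '' U ↔ ∃ z ∈ slice U I, symNorm (fun k => stem f I k z) p = 0 := by
  constructor
  · rintro ⟨q, hq, rfl⟩
    obtain ⟨J, hJ, z, rfl⟩ := exists_sliceMap_eq q
    have hz : z ∈ slice U I := by rw [hU.slice_eq hI hJ]; exact hq
    exact ⟨z, hz, (symNorm_eq_zero_iff _ _ _).2
      ⟨J, hJ, (hf.apply_sliceMap hΩ hsymm hI hJ (hUΩ hz)).symm⟩⟩
  · rintro ⟨z, hz, h⟩
    obtain ⟨J, hJ, h⟩ := (symNorm_eq_zero_iff _ _ _).1 h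
    have hz' : z ∈ slice U J := by rwa [hU.slice_eq hJ hI]
    exact ⟨sliceMap J z, hz', (hf.apply_sliceMap hΩ hsymm hI hJ (hUΩ hz)).trans h⟩

/-- If the symmetrization of `f - p` vanishes identically, then `f` is constant. -/
theorem IsRegularOn.eq_of_symNorm_eq_zero (hΩ : IsSliceDomain Ω) (hsymm : IsSymmetric Ω)
    (hf : IsRegularOn f Ω) {I : ℍ} (hI : I ∈ imaginaryUnits) {p : ℍ}
    (h : ∀ z ∈ slice Ω I, symNorm (fun k => stem f I k z) p = 0) : ∀ q ∈ Ω, f q = p := by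
  obtain ⟨x, hx⟩ := hΩ.exists_ofReal_mem_slice I
  -- At real points b = 0, so the sum of squares is |f t - p|².
  have hreal : ∀ t : ℝ, (t : ℂ) ∈ slice Ω I → f t = p := fun t ht => by
    have := h t ht
    simp only [stem_ofReal] at this
    exact (symNorm_coord_eq_zero_iff _ _).1 this
  have hstem : ∀ k, Set.EqOn (stem f I k) (fun _ => (coord k p : ℂ)) (slice Ω I) := fun k =>
    eqOn_of_eq_ofReal (hΩ.isOpen_slice I hI) (hΩ.isConnected_slice I hI).isPreconnected hx
      (hf.differentiableOn_stem hΩ hsymm hI k) (differentiableOn_const _)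
      fun t ht => by rw [stem_ofReal, hreal t ht]
  intro q hq
  obtain ⟨J, hJ, z, rfl⟩ := exists_sliceMap_eq q
  have hz : z ∈ slice Ω I := by rw [hsymm.slice_eq hI hJ]; exact hq
  -- Comparison with the constant function p at the real point 0, where a = p and b = 0.
  obtain ⟨h1, h2⟩ := stem_eq_stem_iff (g := fun _ => p) (J := I) (w := (0 : ℝ)) |>.1 fun k => by
    rw [hstem k hz, stem_ofReal]
  rw [hf.apply_sliceMap hΩ hsymm hI hJ hz, h1, h2, evenPart_ofReal, oddPart_ofReal, mul_zero,
    add_zero]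

theorem IsRegularOn.isOpen_image (hΩ : IsSliceDomain Ω) (hsymm : IsSymmetric Ω)
    (hf : IsRegularOn f Ω) (hnc : ¬ ∃ c, ∀ q ∈ Ω, f q = c) {U : Set ℍ} (hUΩ : U ⊆ Ω)
    (hUo : IsOpen U) (hU : IsSymmetric U) : IsOpen (f '' U) := by
  obtain ⟨I, hI⟩ := exists_mem_imaginaryUnits
  rw [isOpen_iff_mem_nhds]
  intro p hp
  obtain ⟨z₀, hz₀, h0⟩ := (hf.mem_image_iff hΩ hsymm hUΩ hU hI p).1 hp
  have hne : ∃ z ∈ slice Ω I, symNorm (fun k => stem f I k z) p ≠ 0 := by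
    by_contra! h
    exact hnc ⟨p, hf.eq_of_symNorm_eq_zero hΩ hsymm hI h⟩
  have hDo := hΩ.isOpen_slice I hI
  have hstem := hf.differentiableOn_stem hΩ hsymm hI
  have ev := eventually_exists_zero (N := fun p z => symNorm (fun k => stem f I k z) p) hDo
    (hΩ.isConnected_slice I hI).isPreconnected (hUo.preimage (continuous_sliceMap I))
    (Set.preimage_mono hUΩ) (fun p => ?_) (fun z hz => ?_) hz₀ h0 hne
  · exact ev.mono fun q hq => (hf.mem_image_iff hΩ hsymm hUΩ hU hI q).2 hq
  · exact differentiableOn_symNorm hstem p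
  · have hcont : ContinuousAt (fun x : ℍ × ℂ => ((fun k => stem f I k x.2), x.1)) (p, z) := by
      refine ContinuousAt.prodMk (continuousAt_pi.2 fun k => ?_) continuousAt_fst
      exact ContinuousAt.comp (f := Prod.snd) (x := (p, z))
        ((hstem k).continuousOn.continuousAt (hDo.mem_nhds hz)) continuousAt_snd
    exact ContinuousAt.comp (f := fun x : ℍ × ℂ => ((fun k => stem f I k x.2), x.1))
      (g := fun x : (Fin 4 → ℂ) × ℍ => symNorm x.1 x.2) continuous_symNorm.continuousAt hcont

end Regular

end SliceRegular

end

theorem mainTheorem6 (Ω : Set (Quaternion ℝ)) (hΩ : SliceRegular.IsSliceDomain Ω)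
    (hsymm : SliceRegular.IsSymmetric Ω)
    (f : Quaternion ℝ → Quaternion ℝ) (hf : SliceRegular.IsRegularOn f Ω)
    (hnc : ¬ ∃ c : Quaternion ℝ, ∀ q ∈ Ω, f q = c) :
    (∀ U : Set (Quaternion ℝ), U ⊆ Ω → IsOpen U → SliceRegular.IsSymmetric U →
      IsOpen (f '' U)) ∧ IsOpen (f '' Ω) :=
  ⟨fun _ hUΩ hUo hU => hf.isOpen_image hΩ hsymm hnc hUΩ hUo hU,
    hf.isOpen_image hΩ hsymm hnc subset_rfl hΩ.isOpen hsymm⟩
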